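/- Let $d\ge 0$ and $n\ge 1$ be integers. For groups $B$ and $A$ let $B\wr A=\big(\bigoplus_{A}B\big)\rtimes A$ be the (restricted) regular wreath product, where $A$ acts on the finitely supported functions $A\to B$ through left multiplication on $A$. If $Y$ generates $B$ and $X$ generates $A$, the natural generating set of $B\wr A$ is $\{(y,1): y\in Y\}\cup\{(1,x): x\in X\}$, where $(y,1)$ denotes the function with value $y$ at the identity of $A$ and trivial values elsewhere. An element of a group is a palindrome with respect to a generating set $S$ if it can be written as $s_1^{p_1}s_2^{p_2}\cdots s_k^{p_k}$ with $k\ge 0$, $s_j\in S$, $p_j\in\mathbb{Z}$, and $s_j=s_{k-j+1}$, $p_j=p_{k-j+1}$ for all $j$. The palindromic width of a group with respect to $S$ is the least integer $m$ such that every element is a product of at most $m$ palindromes with respect to $S$ (and $\infty$ if there is no such $m$). Theorem. Let $F_d$ be the free group of rank $d$. The palindromic width of $F_d\wr\mathbb{Z}^n$ with respect to the natural generating set coming from a free basis of $F_d$ and the standard basis of $\mathbb{Z}^n$ is finite, and it is at most $5d+9n$ if $n$ is even and at most $5d+9n+2$ if $n$ is odd. More generally, if $G$ is any group generated by elements $x_1,\dots,x_d$,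 then the palindromic width of $G\wr\mathbb{Z}^n$ with respect to the natural generating set coming from $\{x_1,\dots,x_d\}$ and the standard basis of $\mathbb{Z}^n$ is at most $5d+9n$ if $n$ is even and at most $5d+9n+2$ if $n$ is odd. -/

import Mathlib

/-- An element `g` of a group `G` is a palindrome in the alphabet `X` if it is represented by a word
`x₁ ^ p₁ * ⋯ * x_k ^ p_k`, with letters `x_j ∈ X` and integer exponents `p_j`, such that the list of
pairs `(x_j, p_j)` reads the same backwards. -/
def IsPalindromeIn {G : Type*} [Group G] (X : Set G) (g : G) : Prop :=
  ∃ w : List (G × ℤ), (∀ s ∈ w, s.1 ∈ X) ∧ w.reverse = w ∧ (w.map fun s => s.1 ^ s.2).prod = g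

/-- `g` is a product of at most `k` palindromes in the alphabet `X`. -/
def IsProdOfPalindromes {G : Type*} [Group G] (X : Set G) (k : ℕ) (g : G) : Prop :=
  ∃ l : List G, l.length ≤ k ∧ (∀ p ∈ l, IsPalindromeIn X p) ∧ l.prod = g

/-- The palindromic width `pw(G, X)`: the least `k` such that every element of `G` is a product of
at most `k` palindromes in the alphabet `X`, and `⊤` if there is no such `k`. -/
noncomputable def palindromicWidth {G : Type*} [Group G] (X : Set G) : ℕ∞ :=
  ⨅ (k : ℕ) (_ : ∀ g : G, IsProdOfPalindromes X k g), (k : ℕ∞)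

/-- The (restricted) regular wreath product of `B` and `A`: the pairs `(f, a)` with `f : A → B` of
finite support, inside Mathlib's unrestricted regular wreath product, in which `A` acts on the
functions `A → B` through left multiplication on `A`. -/
def RestrictedWreath (B A : Type*) [Group B] [Group A] : Subgroup (RegularWreathProduct B A) where
  carrier := {w | (Function.mulSupport w.left).Finite}
  one_mem' := by simp
  mul_mem' := by
    intro v w hv hw
    have h : (Function.mulSupport fun x => w.left (v.right⁻¹ * x)).Finite :=
      Set.Finite.preimage (mul_right_injective v.right⁻¹).injOn hw
    exact (hv.union h).subset (Function.mulSupport_mul _ _)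
  inv_mem' := by
    intro w hw
    have h : (Function.mulSupport fun x => w.left (w.right * x)).Finite :=
      Set.Finite.preimage (mul_right_injective w.right).injOn hw
    refine h.subset fun x hx => ?_
    simpa [Function.mem_mulSupport] using hx

/-- The element `(b, 1)` of the wreath product: the function that takes the value `b` at `1` and is
trivial elsewhere, paired with the identity of `A`. -/
noncomputable def RestrictedWreath.base {B : Type*} (A : Type*) [Group B] [Group A] (b : B) :
    RestrictedWreath B A :=
  open Classical in
  ⟨⟨Pi.mulSingle 1 b, 1⟩, (Set.finite_singleton (1 : A)).subset Pi.mulSupport_mulSingle_subset⟩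

/-- The element `(1, a)` of the wreath product. -/
def RestrictedWreath.top (B : Type*) {A : Type*} [Group B] [Group A] (a : A) :
    RestrictedWreath B A :=
  ⟨⟨1, a⟩, by simp [RestrictedWreath]⟩

/-- The natural generating set `{(y, 1) | y ∈ Y} ∪ {(1, x) | x ∈ X}` of the wreath product. -/
def RestrictedWreath.naturalGens {B A : Type*} [Group B] [Group A] (Y : Set B) (X : Set A) :
    Set (RestrictedWreath B A) :=
  RestrictedWreath.base A '' Y ∪ RestrictedWreath.top B '' X

/-- The free abelian group `ℤⁿ`, written multiplicatively. -/
abbrev FreeAb (n : ℕ) : Type := Multiplicative (Fin n → ℤ)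

/-- The standard generating set of `ℤⁿ`: the `n` standard unit vectors. -/
def FreeAb.standardGens (n : ℕ) : Set (FreeAb n) :=
  Set.range fun i : Fin n => Multiplicative.ofAdd (Pi.single i (1 : ℤ))

/-! The argument gives the bound `d + 4 * n + 6`, which lies below the stated ones. Its engine is
that a commutator `g s^k g⁻¹ s^{-k}` with a power of a letter is a product of three palindromes,
whatever `g` is. Taking `g = (F, 1)` and `s` a standard generator of `ℤⁿ`, every quotient of a
finitely supported function `F` by a translate `τF` along an axis costs three palindromes.

Write an element as `(f, a)`. Along each axis, `f = F h (τF)⁻¹` with `h` supported where that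
coordinate vanishes, so `f = (F h F⁻¹) (F (τF)⁻¹)`. After `n` axes and `3 * n` palindromes only a
value at the origin is left. Modulo the commutator subgroup of `G` this value is a product of `d`
powers of generators, hence of `d` palindromes. A remaining `c` in the commutator subgroup costs
six, because placed at the origin it is a product of two translate quotients, by 1 and by 2
(`exists_translate_quotients_of_mem_commutator`). Finally `a` costs `n` palindromes. -/

/-! ### Products of palindromes in an arbitrary group. -/

theorem IsPalindromeIn.zpow {G : Type*} [Group G] {X : Set G} {s : G} (hs : s ∈ X) (k : ℤ) :
    IsPalindromeIn X (s ^ k) :=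
  ⟨[(s, k)], by simpa using hs, by simp, by simp⟩

theorem IsPalindromeIn.isProdOfPalindromes {G : Type*} [Group G] {X : Set G} {g : G}
    (h : IsPalindromeIn X g) : IsProdOfPalindromes X 1 g :=
  ⟨[g], by simp, by simpa using h, by simp⟩

theorem IsProdOfPalindromes.one {G : Type*} [Group G] (X : Set G) (k : ℕ) :
    IsProdOfPalindromes X k (1 : G) :=
  ⟨[], by simp, by simp, by simp⟩

theorem IsProdOfPalindromes.mono {G : Type*} [Group G] {X : Set G} {k l : ℕ} (hkl : k ≤ l) {g : G}
    (h : IsProdOfPalindromes X k g) : IsProdOfPalindromes X l g := by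
  obtain ⟨w, hw, hp, rfl⟩ := h
  exact ⟨w, hw.trans hkl, hp, rfl⟩

theorem IsProdOfPalindromes.mul {G : Type*} [Group G] {X : Set G} {k l : ℕ} {g h : G}
    (hg : IsProdOfPalindromes X k g) (hh : IsProdOfPalindromes X l h) :
    IsProdOfPalindromes X (k + l) (g * h) := by
  obtain ⟨v, hv, hpv, rfl⟩ := hg
  obtain ⟨w, hw, hpw, rfl⟩ := hh
  refine ⟨v ++ w, by simpa using Nat.add_le_add hv hw, fun p hp => ?_, by simp⟩
  rcases List.mem_append.1 hp with hp | hp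
  exacts [hpv p hp, hpw p hp]

/-- A product of `d` powers of letters is a product of `d` palindromes. -/
theorem IsProdOfPalindromes.list_ofFn_zpow {G : Type*} [Group G] {X : Set G} {d : ℕ} {s : Fin d → G}
    (hs : ∀ i, s i ∈ X) (k : Fin d → ℤ) :
    IsProdOfPalindromes X d (List.ofFn fun i => s i ^ k i).prod := by
  refine ⟨_, by simp, fun p hp => ?_, rfl⟩
  obtain ⟨i, rfl⟩ := (List.mem_ofFn' _ _).1 hp
  exact .zpow (hs i) _

theorem exists_word_of_mem_closure {G : Type*} [Group G] {X : Set G} {g : G}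
    (hg : g ∈ Subgroup.closure X) :
    ∃ w : List (G × ℤ), (∀ s ∈ w, s.1 ∈ X) ∧ (w.map fun s => s.1 ^ s.2).prod = g := by
  induction hg using Subgroup.closure_induction_left with
  | one => exact ⟨[], by simp, by simp⟩
  | mul_left x hx y _ ih =>
    obtain ⟨w, hw, rfl⟩ := ih
    exact ⟨(x, 1) :: w, by simpa [hx] using hw, by simp⟩
  | inv_mul_cancel x hx y _ ih =>
    obtain ⟨w, hw, rfl⟩ := ih
    exact ⟨(x, -1) :: w, by simpa [hx] using hw, by simp⟩

theorem prod_map_zpow_neg_reverse {G : Type*} [Group G] (w : List (G × ℤ)) :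
    ((w.map fun s => (s.1, -s.2)).reverse.map fun s => s.1 ^ s.2).prod =
      ((w.map fun s => s.1 ^ s.2).prod)⁻¹ := by
  induction w with
  | nil => simp
  | cons a w ih => simp_all

/-- The commutator of any element with a power of a letter is a product of three palindromes. -/
theorem IsProdOfPalindromes.commutator_zpow {G : Type*} [Group G] {X : Set G} {g s : G}
    (hg : g ∈ Subgroup.closure X) (hs : s ∈ X) (k : ℤ) :
    IsProdOfPalindromes X 3 (g * s ^ k * g⁻¹ * (s ^ k)⁻¹) := by
  obtain ⟨w, hw, rfl⟩ := exists_word_of_mem_closure hg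
  set u : List (G × ℤ) := w.map fun s => (s.1, -s.2) with hu
  have hu' : ∀ s ∈ u, s.1 ∈ X := by
    intro s hs
    obtain ⟨t, ht, rfl⟩ := List.mem_map.1 hs
    exact hw t ht
  have hr : (u.map fun s => s.1 ^ s.2).prod = ((w.reverse.map fun s => s.1 ^ s.2).prod)⁻¹ := by
    rw [← prod_map_zpow_neg_reverse, hu]
    simp
  -- With `g'` the value of the reversed word of `g`, the factorization is `(g g') (g'⁻¹ s^k g⁻¹)
  -- s^{-k}`. The word `u` spells `g'⁻¹`, and its reverse spells `g⁻¹`.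
  have h1 : IsPalindromeIn X
      ((w.map fun s => s.1 ^ s.2).prod * (w.reverse.map fun s => s.1 ^ s.2).prod) :=
    ⟨w ++ w.reverse, by simpa [or_imp] using hw, by simp, by simp⟩
  have h2 : IsPalindromeIn X (((w.reverse.map fun s => s.1 ^ s.2).prod)⁻¹ * s ^ k *
      ((w.map fun s => s.1 ^ s.2).prod)⁻¹) := by
    refine ⟨u ++ (s, k) :: u.reverse, fun t ht => ?_, by simp, ?_⟩
    · simp only [List.mem_append, List.mem_cons, List.mem_reverse] at ht
      rcases ht with h | rfl | h
      exacts [hu' t h, hs, hu' t h]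
    · rw [← prod_map_zpow_neg_reverse w, ← hr]
      simp [mul_assoc, hu]
  have h3 : IsPalindromeIn X ((s ^ k)⁻¹) := by
    rw [← zpow_neg]
    exact .zpow hs _
  have := (h1.isProdOfPalindromes.mul h2.isProdOfPalindromes).mul h3.isProdOfPalindromes
  simpa [mul_assoc] using this

/-! ### Commutators spread along a line. -/

/-- Every element of a group generated by `x₁, …, x_d` is `x₁ ^ k₁ ⋯ x_d ^ k_d` up to an element of
the commutator subgroup. -/
theorem exists_eq_list_prod_mul_commutator {G : Type*} [Group G] {d : ℕ} {x : Fin d → G}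
    (hx : Subgroup.closure (Set.range x) = ⊤) (g : G) :
    ∃ k : Fin d → ℤ, ∃ c ∈ commutator G, g = (List.ofFn fun i => x i ^ k i).prod * c := by
  have hg : Abelianization.of g ∈ Subgroup.closure (Set.range fun i => Abelianization.of (x i)) := by
    have : (Set.range fun i => Abelianization.of (x i)) = Abelianization.of '' Set.range x := by
      rw [← Set.range_comp]; rfl
    rw [this, ← MonoidHom.map_closure, hx]
    exact Subgroup.mem_map_of_mem _ trivial
  obtain ⟨k, hk⟩ := Subgroup.exists_of_mem_closure_range _ _ hg
  refine ⟨k, ((List.ofFn fun i => x i ^ k i).prod)⁻¹ * g, ?_, by simp⟩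
  rw [← Abelianization.ker_of, MonoidHom.mem_ker, map_mul, map_inv, hk, map_list_prod, List.map_ofFn,
    inv_mul_eq_one, List.prod_ofFn]
  simp

/-- A sequence whose quotients by its translate by `2` have consecutive products ending at a given
element of the commutator subgroup. -/
theorem exists_partialProducts_of_mem_commutator {G : Type*} [Group G] {c : G}
    (hc : c ∈ commutator G) :
    ∃ (N : ℤ) (F P : ℤ → G), 0 ≤ N ∧ (∀ x < 0, F x = 1) ∧ (∀ x, N ≤ x → F x = 1) ∧
      (∀ x ≤ 0, P x = 1) ∧ (∀ x, N ≤ x → P x = c) ∧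
      ∀ x, P (x + 1) = P x * (F x * (F (x - 2))⁻¹) := by
  have step : ∀ (c a b : G), (∃ (N : ℤ) (F P : ℤ → G), 0 ≤ N ∧ (∀ x < 0, F x = 1) ∧
      (∀ x, N ≤ x → F x = 1) ∧ (∀ x ≤ 0, P x = 1) ∧ (∀ x, N ≤ x → P x = c) ∧
      ∀ x, P (x + 1) = P x * (F x * (F (x - 2))⁻¹)) →
      ∃ (N : ℤ) (F P : ℤ → G), 0 ≤ N ∧ (∀ x < 0, F x = 1) ∧
      (∀ x, N ≤ x → F x = 1) ∧ (∀ x ≤ 0, P x = 1) ∧ (∀ x, N ≤ x → P x = c * (a * b * a⁻¹ * b⁻¹)) ∧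
      ∀ x, P (x + 1) = P x * (F x * (F (x - 2))⁻¹) := by
    rintro c a b ⟨N, F, P, hN, hF0, hF1, hP0, hP1, h⟩
    -- Since `P` is constant from `N` on, the factor `(F (x - 2))⁻¹` is already trivial there, so a
    -- new block can start at `N` without interference.
    have hF2 : ∀ x, N - 2 ≤ x → F x = 1 := by
      intro x hx
      have h' := h (x + 2)
      rw [hP1 _ (by linarith), hP1 _ (by linarith), hF1 _ (by linarith)] at h'
      simpa using h'
    -- Placing `a, b` at `N, N + 1` makes the quotients by the 2-translate read `a, b, a⁻¹, b⁻¹` on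
    -- the next four points: a commutator is appended.
    refine ⟨N + 4, fun x => if x = N then a else if x = N + 1 then b else F x,
      fun x => if x ≤ N then P x else if x = N + 1 then c * a else if x = N + 2 then c * a * b else
        if x = N + 3 then c * a * b * a⁻¹ else c * (a * b * a⁻¹ * b⁻¹), by linarith, ?_, ?_, ?_, ?_, ?_⟩
    · intro x hx
      simp [show x ≠ N by lia, show x ≠ N + 1 by lia, hF0 x hx]
    · intro x hx
      simp [show x ≠ N by lia, show x ≠ N + 1 by lia, hF1 x (by lia)]
    · intro x hx
      simp [show x ≤ N by lia, hP0 x hx]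
    · intro x hx
      simp [show ¬ x ≤ N by lia, show x ≠ N + 1 by lia, show x ≠ N + 2 by lia,
        show x ≠ N + 3 by lia]
    · intro x
      have hcases : x < N ∨ x = N ∨ x = N + 1 ∨ x = N + 2 ∨ x = N + 3 ∨ N + 4 ≤ x := by lia
      rcases hcases with hx | rfl | rfl | rfl | rfl | hx
      · simp [show x + 1 ≤ N by lia, show x ≤ N by lia, show x ≠ N by lia, show x ≠ N + 1 by lia,
          show x - 2 ≠ N by lia, show x - 2 ≠ N + 1 by lia, h x]
      · simp [hF2 (x - 2) le_rfl, hP1 x le_rfl, show x - 2 ≠ x + 1 by lia]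
      · simp [hF2 (N + 1 - 2) (by lia), show N + 1 + 1 = N + 2 by lia, show N + 1 - 2 ≠ N by lia,
          show N + 1 - 2 ≠ N + 1 by lia]
      · simp [hF2 (N + 2) (by lia), show N + 2 + 1 = N + 3 by lia]
      · simp [hF2 (N + 3) (by lia), show N + 3 + 1 = N + 4 by lia, show N + 3 - 2 = N + 1 by lia,
          mul_assoc]
      · simp [show ¬ x + 1 ≤ N by lia, show ¬ x ≤ N by lia, show x ≠ N by lia,
          show x ≠ N + 1 by lia, show x ≠ N + 2 by lia, show x ≠ N + 3 by lia,
          show x + 1 ≠ N + 2 by lia, show x + 1 ≠ N + 3 by lia,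
          show x - 2 ≠ N by lia, show x - 2 ≠ N + 1 by lia, hF1 x (by lia), hF1 (x - 2) (by lia)]
  rw [commutator_eq_closure] at hc
  induction hc using Subgroup.closure_induction_right with
  | one => exact ⟨0, 1, 1, by simp⟩
  | mul_right c _ y hy ih =>
    obtain ⟨a, b, rfl⟩ := hy
    exact step c a b ih
  | mul_inv_cancel c _ y hy ih =>
    obtain ⟨a, b, rfl⟩ := hy
    rw [commutatorElement_inv]
    exact step c b a ih

/-- An element of the commutator subgroup, put at one point of a line, is a product of two
functions which are quotients by a translate. -/
theorem exists_translate_quotients_of_mem_commutator {G : Type*} [Group G] {c : G}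
    (hc : c ∈ commutator G) :
    ∃ U V : ℤ → G, (Function.mulSupport U).Finite ∧ (Function.mulSupport V).Finite ∧
      ∀ x, U x * (U (x - 1))⁻¹ * (V x * (V (x - 2))⁻¹) = if x = 0 then c else 1 := by
  obtain ⟨N, F, P, hN, hF0, hF1, hP0, hP1, h⟩ := exists_partialProducts_of_mem_commutator hc
  -- The line is shifted so that the product is complete at 0. For `x < 0` the quotient of `U`
  -- telescopes to the inverse of that of `V`; cutting `U` off at 0 leaves exactly `P N = c` there.
  refine ⟨fun x => if x + 1 ≤ 0 then (P (x + 1 + N))⁻¹ else 1, fun x => F (x + N), ?_, ?_, ?_⟩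
  · refine (Set.finite_Icc (-N - 1) 0).subset fun x hx => ?_
    by_contra hx'
    refine hx ?_
    simp only [Set.mem_Icc, not_and_or, not_le] at hx'
    dsimp only
    split_ifs with h0
    · rw [hP0 _ (by lia), inv_one]
    · rfl
  · refine (Set.finite_Icc (-N) 0).subset fun x hx => ?_
    by_contra hx'
    refine hx ?_
    simp only [Set.mem_Icc, not_and_or, not_le] at hx'
    rcases hx' with hx' | hx'
    exacts [hF0 _ (by lia), hF1 _ (by lia)]
  · intro x
    have hx := h (x + N)
    have e1 : x - 2 + N = x + N - 2 := by ring
    have e2 : x + 1 + N = x + N + 1 := by ring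
    simp only [sub_add_cancel, e1, e2]
    rcases lt_trichotomy x 0 with h0 | h0 | h0
    · simp [show x + 1 ≤ 0 by lia, show x ≤ 0 by lia, h0.ne, hx]
    · subst h0
      rw [zero_add] at hx ⊢
      rw [hP1 _ (by lia), hP1 _ le_rfl] at hx
      simp only [left_eq_mul] at hx
      simp [hP1 N le_rfl, hx]
    · rw [hP1 _ (by lia), hP1 _ (by lia)] at hx
      simp only [left_eq_mul] at hx
      simp [show ¬ x + 1 ≤ 0 by lia, show ¬ x ≤ 0 by lia, h0.ne', hx]

/-! ### Functions inside the wreath product, and generation by the natural generators. -/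

namespace RestrictedWreath

/-- The element `(f, 1)` of the restricted wreath product. -/
def ofFun {B A : Type*} [Group B] [Group A] (f : A → B) (hf : (Function.mulSupport f).Finite) :
    RestrictedWreath B A :=
  ⟨⟨f, 1⟩, hf⟩

theorem ext_iff {B A : Type*} [Group B] [Group A] {v w : RestrictedWreath B A} :
    v = w ↔ (∀ x, v.1.left x = w.1.left x) ∧ v.1.right = w.1.right := by
  rw [Subtype.ext_iff, RegularWreathProduct.ext_iff, funext_iff]

theorem base_left {B A : Type*} [Group B] [Group A] [DecidableEq A] (b : B) (x : A) :
    (base A b).1.left x = if x = 1 then b else 1 := by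
  classical
  simp [base, Pi.mulSingle_apply]

theorem base_right {B A : Type*} [Group B] [Group A] (b : B) : (base A b).1.right = 1 := rfl

/-- `base` as a homomorphism. -/
noncomputable def baseHom (B A : Type*) [Group B] [Group A] : B →* RestrictedWreath B A where
  toFun := base A
  map_one' := by classical simp [ext_iff, base_left, base_right]
  map_mul' a b := by
    classical
    simp only [ext_iff, base_left, base_right, Subgroup.coe_mul, RegularWreathProduct.mul_left,
      RegularWreathProduct.mul_right, Pi.mul_apply]
    refine ⟨fun x => ?_, by simp⟩
    by_cases hx : x = 1 <;> simp [hx]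

/-- `top` as a homomorphism. -/
def topHom (B A : Type*) [Group B] [Group A] : A →* RestrictedWreath B A where
  toFun := top B
  map_one' := rfl
  map_mul' a b := by simp [ext_iff, top]

theorem eq_ofFun_mul_top {B A : Type*} [Group B] [Group A] (w : RestrictedWreath B A) :
    w = ofFun w.1.left w.2 * top B w.1.right := by
  simp [ext_iff, ofFun, top]

theorem ofFun_eq_mul {B A : Type*} [Group B] [Group A] {f g h : A → B}
    (hf : (Function.mulSupport f).Finite) (hg : (Function.mulSupport g).Finite)
    (hh : (Function.mulSupport h).Finite) (H : ∀ x, f x = g x * h x) :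
    ofFun f hf = ofFun g hg * ofFun h hh := by
  simp [ext_iff, ofFun, H]

/-- Conjugation by `top B a` translates functions by `a`. With `h = 1` this turns a translate
quotient into a commutator. -/
theorem ofFun_eq_conj {B A : Type*} [Group B] [Group A] {f F h : A → B}
    (hf : (Function.mulSupport f).Finite) (hF : (Function.mulSupport F).Finite)
    (hh : (Function.mulSupport h).Finite) (a : A)
    (H : ∀ x, f x = F x * h x * (F (a⁻¹ * x))⁻¹) :
    ofFun f hf = ofFun F hF * ofFun h hh * top B a * (ofFun F hF)⁻¹ * (top B a)⁻¹ := by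
  simp [ext_iff, ofFun, top, H, mul_assoc]

/-- The natural generating set generates the restricted wreath product. -/
theorem closure_naturalGens {B A : Type*} [Group B] [Group A] {Y : Set B} {X : Set A}
    (hY : Subgroup.closure Y = ⊤) (hX : Subgroup.closure X = ⊤) :
    Subgroup.closure (naturalGens Y X) = ⊤ := by
  classical
  have hbase : ∀ b, base A b ∈ Subgroup.closure (naturalGens Y X) := by
    intro b
    have hb : baseHom B A b ∈ (Subgroup.closure Y).map (baseHom B A) :=
      Subgroup.mem_map_of_mem _ (hY ▸ Subgroup.mem_top b)
    rw [MonoidHom.map_closure] at hb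
    exact Subgroup.closure_mono Set.subset_union_left hb
  have htop : ∀ a, top B a ∈ Subgroup.closure (naturalGens Y X) := by
    intro a
    have ha : topHom B A a ∈ (Subgroup.closure X).map (topHom B A) :=
      Subgroup.mem_map_of_mem _ (hX ▸ Subgroup.mem_top a)
    rw [MonoidHom.map_closure] at ha
    exact Subgroup.closure_mono Set.subset_union_right ha
  have hfun : ∀ (s : Finset A) (f : A → B) (hf : (Function.mulSupport f).Finite),
      (∀ x, x ∉ s → f x = 1) → ofFun f hf ∈ Subgroup.closure (naturalGens Y X) := by
    intro s
    induction s using Finset.induction_on with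
    | empty =>
      intro f hf h
      have e : ofFun f hf = 1 := by simpa [ext_iff, ofFun] using h
      exact e ▸ one_mem _
    | insert a s ha ih =>
      intro f hf h
      have hg : (Function.mulSupport (Function.update f a 1)).Finite :=
        hf.subset fun x hx => by
          by_cases hxa : x = a
          · simp [hxa] at hx
          · simpa [hxa] using hx
      -- The value at `a` is split off as a translate of a function supported at the identity.
      have e : ofFun f hf = top B a * base A (f a) * (top B a)⁻¹ * ofFun _ hg := by
        simp only [ext_iff, Subgroup.coe_mul, Subgroup.coe_inv, RegularWreathProduct.mul_left,
          RegularWreathProduct.mul_right, RegularWreathProduct.inv_right, Pi.mul_apply, base_left,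
          base_right, RegularWreathProduct.inv_left]
        refine ⟨fun x => ?_, by simp [ofFun, top]⟩
        by_cases hxa : x = a
        · subst hxa
          simp [ofFun, top]
        · have : a⁻¹ * x ≠ 1 := fun h => hxa (inv_mul_eq_one.1 h).symm
          simp [ofFun, top, hxa, this]
      rw [e]
      refine mul_mem (mul_mem (mul_mem (htop a) (hbase _)) (inv_mem (htop a))) (ih _ hg ?_)
      intro x hx
      by_cases hxa : x = a
      · simp [hxa]
      · simpa [hxa] using h x (by simp [hxa, hx])
  refine eq_top_iff.2 fun w _ => ?_
  have hw : (Function.mulSupport w.1.left).Finite := w.2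
  rw [eq_ofFun_mul_top w]
  exact mul_mem (hfun (Set.Finite.toFinset hw) _ hw fun x hx => by simpa using hx) (htop _)

end RestrictedWreath

/-! ### Finitely supported functions on `ℤⁿ` up to twisted conjugation. -/

namespace FreeAb

/-- The `i`-th standard generator of `ℤⁿ`. -/
def gen {n : ℕ} (i : Fin n) : FreeAb n := Multiplicative.ofAdd (Pi.single i (1 : ℤ))

theorem list_prod_gen_zpow {n : ℕ} (a : FreeAb n) :
    (List.ofFn fun i => gen i ^ (Multiplicative.toAdd a i)).prod = a := by
  rw [List.prod_ofFn]
  apply Multiplicative.toAdd.injective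
  funext j
  simp [gen, toAdd_prod, Finset.sum_apply, Pi.single_apply]

theorem closure_standardGens (n : ℕ) : Subgroup.closure (standardGens n) = ⊤ := by
  refine eq_top_iff.2 fun a _ => ?_
  rw [← list_prod_gen_zpow a]
  refine Subgroup.list_prod_mem _ fun x hx => ?_
  obtain ⟨i, rfl⟩ := (List.mem_ofFn' _ _).1 hx
  exact zpow_mem (Subgroup.subset_closure (Set.mem_range_self i)) _

theorem toAdd_gen_zpow_inv_mul {n : ℕ} (i j : Fin n) (k : ℤ) (x : FreeAb n) :
    Multiplicative.toAdd ((gen i ^ k)⁻¹ * x) j =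
      Multiplicative.toAdd x j - if j = i then k else 0 := by
  simp [gen, Pi.single_apply]
  ring

theorem toAdd_gen_inv_mul {n : ℕ} (i j : Fin n) (x : FreeAb n) :
    Multiplicative.toAdd ((gen i)⁻¹ * x) j =
      Multiplicative.toAdd x j - if j = i then 1 else 0 := by
  simpa using toAdd_gen_zpow_inv_mul i j 1 x

theorem toAdd_gen_mul {n : ℕ} (i j : Fin n) (x : FreeAb n) :
    Multiplicative.toAdd (gen i * x) j =
      Multiplicative.toAdd x j + if j = i then 1 else 0 := by
  simp [gen, Pi.single_apply, add_comm]

/-- The function on `ℤⁿ` which is `p` along the `i`-th axis and trivial elsewhere. -/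
def axisFun {n : ℕ} {G : Type*} [Group G] (i : Fin n) (p : ℤ → G) (x : FreeAb n) : G :=
  open Classical in
  if ∀ j, j ≠ i → Multiplicative.toAdd x j = 0 then p (Multiplicative.toAdd x i) else 1

theorem mulSupport_axisFun_finite {n : ℕ} {G : Type*} [Group G] (i : Fin n) {p : ℤ → G}
    (hp : (Function.mulSupport p).Finite) : (Function.mulSupport (axisFun i p)).Finite := by
  refine (hp.image fun k => gen i ^ k).subset fun x hx => ?_
  rw [Function.mem_mulSupport, axisFun] at hx
  split_ifs at hx with h
  · refine ⟨_, hx, ?_⟩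
    apply Multiplicative.toAdd.injective
    funext j
    by_cases hj : j = i
    · subst hj
      simp [gen]
    · simp [gen, h j hj, hj]
  · exact absurd rfl hx

theorem axisFun_gen_zpow_inv_mul {n : ℕ} {G : Type*} [Group G] (i : Fin n) (p : ℤ → G) (k : ℤ)
    (x : FreeAb n) : axisFun i p ((gen i ^ k)⁻¹ * x) = axisFun i (fun y => p (y - k)) x := by
  simp only [axisFun, toAdd_gen_zpow_inv_mul, if_true]
  congr 1
  refine propext (forall₂_congr fun j hj => ?_)
  simp [hj]

/-- One step of pushing a finitely supported function on `ℤⁿ` onto a coordinate hyperplane. -/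
theorem exists_twisted_conj_slab {n : ℕ} {G : Type*} [Group G] (i : Fin n) (J : Set (Fin n))
    (hi : i ∉ J) (N : ℕ) (f : FreeAb n → G) (hf : (Function.mulSupport f).Finite)
    (hJ : ∀ x : FreeAb n, ∀ j ∈ J, Multiplicative.toAdd x j ≠ 0 → f x = 1)
    (hN : ∀ x : FreeAb n, N < |Multiplicative.toAdd x i| → f x = 1) :
    ∃ F h : FreeAb n → G, (Function.mulSupport F).Finite ∧ (Function.mulSupport h).Finite ∧
      (∀ x, f x = F x * h x * (F ((gen i)⁻¹ * x))⁻¹) ∧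
      (∀ x : FreeAb n, ∀ j ∈ J, Multiplicative.toAdd x j ≠ 0 → h x = 1) ∧
      ∀ x : FreeAb n, Multiplicative.toAdd x i ≠ 0 → h x = 1 := by
  induction N generalizing f with
  | zero =>
    exact ⟨1, f, by simp, hf, by simp, hJ, fun x hx => hN x (by simpa using hx)⟩
  | succ N ih =>
    -- This `F` clears the two outermost hyperplanes: its values on `N` enter translated and cancel
    -- `f` at `N + 1`, and its values on `-(N + 1)` cancel `f` there directly. The support shrinks
    -- to `|x i| ≤ N`.
    set F : FreeAb n → G := fun x =>
      if Multiplicative.toAdd x i = N then (f (gen i * x))⁻¹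
      else if Multiplicative.toAdd x i = -(N + 1) then f x else 1 with hFdef
    have hF : (Function.mulSupport F).Finite := by
      refine (hf.union (hf.preimage (mul_right_injective (gen i)).injOn)).subset fun x hx => ?_
      by_contra hx'
      simp only [Set.mem_union, Set.mem_preimage, Function.mem_mulSupport, not_or, not_not] at hx'
      exact hx (by simp [hFdef, hx'.1, hx'.2])
    have hFJ : ∀ x : FreeAb n, ∀ j ∈ J, Multiplicative.toAdd x j ≠ 0 → F x = 1 := by
      intro x j hj hx
      have hji : j ≠ i := fun h => hi (h ▸ hj)
      have := hJ (gen i * x) j hj (by simpa only [toAdd_gen_mul, hji, if_false, add_zero] using hx)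
      simp [hFdef, this, hJ x j hj hx]
    set h : FreeAb n → G := fun x => (F x)⁻¹ * f x * F ((gen i)⁻¹ * x) with hhdef
    have hh : (Function.mulSupport h).Finite := by
      refine ((hF.union hf).union (hF.preimage (mul_right_injective (gen i)⁻¹).injOn)).subset
        fun x hx => ?_
      by_contra hx'
      simp only [Set.mem_union, Set.mem_preimage, Function.mem_mulSupport, not_or, not_not] at hx'
      exact hx (by simp [hhdef, hx'.1.1, hx'.1.2, hx'.2])
    have hhJ : ∀ x : FreeAb n, ∀ j ∈ J, Multiplicative.toAdd x j ≠ 0 → h x = 1 := by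
      intro x j hj hx
      have hji : j ≠ i := fun h => hi (h ▸ hj)
      have := hFJ ((gen i)⁻¹ * x) j hj
        (by simpa only [toAdd_gen_inv_mul, hji, if_false, sub_zero] using hx)
      simp only [hhdef, this, hJ x j hj hx, hFJ x j hj hx]
      simp
    have hhN : ∀ x : FreeAb n, (N : ℤ) < |Multiplicative.toAdd x i| → h x = 1 := by
      intro x hx
      simp only [hhdef, hFdef, toAdd_gen_inv_mul, if_true, mul_inv_cancel_left]
      generalize hk : Multiplicative.toAdd x i = k at *
      have hcases : k = N + 1 ∨ k = -(N + 1) ∨ (N + 1 : ℤ) < |k| := by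
        rcases abs_cases k with h | h <;> lia
      rcases hcases with h1 | h1 | h1
      · rw [if_neg (show k ≠ N by lia), if_neg (show k ≠ -(N + 1) by lia),
          if_pos (show k - 1 = N by lia)]
        simp
      · rw [if_neg (show k ≠ N by lia), if_pos h1, if_neg (show k - 1 ≠ N by lia),
          if_neg (show k - 1 ≠ -(N + 1) by lia)]
        simp
      · have h2 : k ≠ N ∧ k ≠ -(N + 1) ∧ k - 1 ≠ N ∧ k - 1 ≠ -(N + 1) := by
          rcases abs_cases k with h | h <;> lia
        rw [if_neg h2.1, if_neg h2.2.1, if_neg h2.2.2.1, if_neg h2.2.2.2,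
          hN x (by rw [hk]; exact_mod_cast h1)]
        simp
    obtain ⟨F', h', hF', hh', e, h1, h2⟩ := ih h hh hhJ hhN
    refine ⟨F * F', h', (hF.union hF').subset (Function.mulSupport_mul _ _), hh', fun x => ?_, h1,
      h2⟩
    have e1 := e x
    have e2 : f x = F x * h x * (F ((gen i)⁻¹ * x))⁻¹ := by simp [hhdef, mul_assoc]
    rw [e2, e1]
    simp [mul_assoc]

theorem exists_twisted_conj {n : ℕ} {G : Type*} [Group G] (i : Fin n) (J : Set (Fin n))
    (hi : i ∉ J) (f : FreeAb n → G) (hf : (Function.mulSupport f).Finite)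
    (hJ : ∀ x : FreeAb n, ∀ j ∈ J, Multiplicative.toAdd x j ≠ 0 → f x = 1) :
    ∃ F h : FreeAb n → G, (Function.mulSupport F).Finite ∧ (Function.mulSupport h).Finite ∧
      (∀ x, f x = F x * h x * (F ((gen i)⁻¹ * x))⁻¹) ∧
      (∀ x : FreeAb n, ∀ j ∈ J, Multiplicative.toAdd x j ≠ 0 → h x = 1) ∧
      ∀ x : FreeAb n, Multiplicative.toAdd x i ≠ 0 → h x = 1 := by
  obtain ⟨N, hN⟩ := (hf.image fun x => (Multiplicative.toAdd x i).natAbs).bddAbove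
  refine exists_twisted_conj_slab i J hi N f hf hJ fun x hx => ?_
  by_contra hfx
  have := hN ⟨x, hfx, rfl⟩
  simp only at this
  rw [Int.abs_eq_natAbs] at hx
  lia

end FreeAb

/-! ### Counting palindromes in `G ≀ ℤⁿ`. -/

namespace RestrictedWreath

open FreeAb

theorem top_gen_mem_naturalGens {n : ℕ} {G : Type*} [Group G] (Y : Set G) (i : Fin n) :
    top G (gen i) ∈ naturalGens Y (standardGens n) :=
  Or.inr ⟨_, ⟨i, rfl⟩, rfl⟩

/-- A function which is the quotient of a finitely supported function by a translate in a coordinate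
direction is a product of three palindromes. -/
theorem isProdOfPalindromes_translate_quotient {n : ℕ} {G : Type*} [Group G] {Y : Set G}
    (hY : Subgroup.closure Y = ⊤) (i : Fin n) (k : ℤ) {f F : FreeAb n → G}
    (hf : (Function.mulSupport f).Finite) (hF : (Function.mulSupport F).Finite)
    (H : ∀ x, f x = F x * (F ((gen i ^ k)⁻¹ * x))⁻¹) :
    IsProdOfPalindromes (naturalGens Y (standardGens n)) 3 (ofFun f hf) := by
  have h1 : (Function.mulSupport (1 : FreeAb n → G)).Finite := by simp
  have e := ofFun_eq_conj hf hF h1 (gen i ^ k) (by simpa using H)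
  have e1 : ofFun (1 : FreeAb n → G) h1 = 1 := rfl
  have e2 : top G (gen i ^ k) = top G (gen i) ^ k := map_zpow (topHom G (FreeAb n)) _ _
  rw [e, e1, e2, mul_one]
  refine .commutator_zpow ?_ (top_gen_mem_naturalGens Y i) k
  rw [closure_naturalGens hY (closure_standardGens n)]
  trivial

/-- The two translate quotients on a line are laid along the `i`-th axis, three palindromes each.
This is where at least one coordinate is needed. -/
theorem isProdOfPalindromes_base_of_mem_commutator {n : ℕ} (i : Fin n) {G : Type*} [Group G]
    {Y : Set G} (hY : Subgroup.closure Y = ⊤) {c : G} (hc : c ∈ commutator G) :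
    IsProdOfPalindromes (naturalGens Y (standardGens n)) 6 (base (FreeAb n) c) := by
  classical
  obtain ⟨U, V, hU, hV, h⟩ := exists_translate_quotients_of_mem_commutator hc
  have hfin : ∀ (p : ℤ → G) (k : ℤ), (Function.mulSupport p).Finite →
      (Function.mulSupport fun x => p x * (p (x - k))⁻¹).Finite := by
    intro p k hp
    refine (hp.union (hp.preimage (sub_left_injective (b := k)).injOn)).subset fun x hx => ?_
    by_contra hx'
    simp only [Set.mem_union, Set.mem_preimage, Function.mem_mulSupport, not_or, not_not] at hx'
    exact hx (by simp [hx'.1, hx'.2])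
  have key : ∀ (p : ℤ → G) (k : ℤ) (hp : (Function.mulSupport p).Finite),
      IsProdOfPalindromes (naturalGens Y (standardGens n)) 3
        (ofFun _ (mulSupport_axisFun_finite i (hfin p k hp))) := by
    intro p k hp
    refine isProdOfPalindromes_translate_quotient hY i k _ (mulSupport_axisFun_finite i hp) ?_
    intro x
    rw [axisFun_gen_zpow_inv_mul]
    simp only [axisFun]
    split_ifs <;> simp
  have e : base (FreeAb n) c = ofFun _ (mulSupport_axisFun_finite i (hfin U 1 hU)) *
      ofFun _ (mulSupport_axisFun_finite i (hfin V 2 hV)) := by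
    simp only [ext_iff, base_left, base_right]
    refine ⟨fun x => ?_, by simp [ofFun]⟩
    have hx : x = 1 ↔ (∀ j, j ≠ i → Multiplicative.toAdd x j = 0) ∧
        Multiplicative.toAdd x i = 0 := by
      constructor
      · rintro rfl
        simp
      · rintro ⟨h1, h2⟩
        apply Multiplicative.toAdd.injective
        funext j
        by_cases hj : j = i
        · subst hj
          exact h2
        · exact h1 j hj
    simp only [ofFun, Subgroup.coe_mul, RegularWreathProduct.mul_left, Pi.mul_apply, inv_one,
      one_mul, axisFun, hx]
    by_cases h1 : ∀ j, j ≠ i → Multiplicative.toAdd x j = 0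
    · rw [if_pos h1, if_pos h1, h]
      exact if_congr (and_iff_right h1) rfl rfl
    · simp [h1]
  rw [e]
  exact (key U 1 hU).mul (key V 2 hV)

/-- A finitely supported function on `ℤⁿ` is, up to three palindromes for each coordinate in a set,
supported where these coordinates vanish. -/
theorem exists_supported_mul_palindromes {n : ℕ} {G : Type*} [Group G] {Y : Set G}
    (hY : Subgroup.closure Y = ⊤) (J : Finset (Fin n)) (f : FreeAb n → G)
    (hf : (Function.mulSupport f).Finite) :
    ∃ (h : FreeAb n → G) (hh : (Function.mulSupport h).Finite) (w : RestrictedWreath G (FreeAb n)),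
      (∀ x : FreeAb n, ∀ j ∈ J, Multiplicative.toAdd x j ≠ 0 → h x = 1) ∧
      IsProdOfPalindromes (naturalGens Y (standardGens n)) (3 * J.card) w ∧
      ofFun f hf = ofFun h hh * w := by
  induction J using Finset.induction_on with
  | empty => exact ⟨f, hf, 1, by simp, .one _ _, by simp⟩
  | insert i J hi ih =>
    obtain ⟨h, hh, w, h1, h2, h3⟩ := ih
    obtain ⟨F, g, hF, hg, e, hgJ, hgi⟩ := exists_twisted_conj i (J : Set (Fin n)) (by simpa using hi)
      h hh (by simpa using h1)
    -- Pointwise conjugation of `g` by `F` does not enlarge its support, and it is what makes the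
    -- other factor a pure translate quotient.
    have hg' : (Function.mulSupport fun x => F x * g x * (F x)⁻¹).Finite :=
      hg.subset fun x hx hgx => hx (by simp [hgx])
    have hq : (Function.mulSupport fun x => F x * (F ((gen i ^ (1 : ℤ))⁻¹ * x))⁻¹).Finite := by
      refine (hF.union (hF.preimage (mul_right_injective (gen i ^ (1 : ℤ))⁻¹).injOn)).subset
        fun x hx => ?_
      by_contra hx'
      simp only [Set.mem_union, Set.mem_preimage, Function.mem_mulSupport, not_or, not_not] at hx'
      exact hx (by simp only [hx'.1, hx'.2]; simp)
    refine ⟨_, hg', ofFun _ hq * w, ?_, ?_, ?_⟩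
    · intro x j hj hx
      have : g x = 1 := by
        rcases Finset.mem_insert.1 hj with rfl | hj
        exacts [hgi x hx, hgJ x j (by simpa using hj) hx]
      simp [this]
    · rw [Finset.card_insert_of_notMem hi, mul_add, mul_one, add_comm]
      exact (isProdOfPalindromes_translate_quotient hY i 1 hq hF fun _ => rfl).mul h2
    · rw [h3, ← mul_assoc]
      congr 1
      refine ofFun_eq_mul _ _ _ fun x => ?_
      rw [e x]
      simp [mul_assoc]

theorem isProdOfPalindromes_of_closure_eq_top {d n : ℕ} (i : Fin n) {G : Type*} [Group G]
    {x : Fin d → G} (hx : Subgroup.closure (Set.range x) = ⊤) (w : RestrictedWreath G (FreeAb n)) :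
    IsProdOfPalindromes (naturalGens (Set.range x) (standardGens n)) (d + 6 + 3 * n + n) w := by
  classical
  obtain ⟨h, hh, v, h1, h2, h3⟩ := exists_supported_mul_palindromes hx Finset.univ w.1.left w.2
  obtain ⟨k, c, hc, hk⟩ := exists_eq_list_prod_mul_commutator hx (h 1)
  have e1 : ofFun h hh = base (FreeAb n) (h 1) := by
    simp only [ext_iff, base_left, base_right]
    refine ⟨fun y => ?_, rfl⟩
    split_ifs with hy
    · rw [hy]
      rfl
    · by_contra hy'
      refine hy (Multiplicative.toAdd.injective (funext fun j => ?_))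
      by_contra hj
      exact hy' (h1 y j (Finset.mem_univ _) hj)
  have e2 : base (FreeAb n) (h 1) =
      (List.ofFn fun i => base (FreeAb n) (x i) ^ k i).prod * base (FreeAb n) c := by
    change baseHom G (FreeAb n) (h 1) = _ * baseHom G (FreeAb n) c
    rw [hk, map_mul, map_list_prod, List.map_ofFn]
    congr 3
    funext i
    exact map_zpow (baseHom G (FreeAb n)) _ _
  have e3 : top G w.1.right =
      (List.ofFn fun i => top G (gen i) ^ (Multiplicative.toAdd w.1.right i)).prod := by
    change topHom G (FreeAb n) w.1.right = _
    conv_lhs => rw [← list_prod_gen_zpow w.1.right, map_list_prod, List.map_ofFn]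
    congr 2
    funext i
    exact map_zpow (topHom G (FreeAb n)) _ _
  rw [eq_ofFun_mul_top w, h3, e1, e2, e3]
  refine .mul (.mul (.mul ?_ ?_) ?_) ?_
  · exact .list_ofFn_zpow (s := fun j => base (FreeAb n) (x j))
      (fun j => Or.inl (Set.mem_image_of_mem _ (Set.mem_range_self j))) k
  · exact isProdOfPalindromes_base_of_mem_commutator i hx hc
  · simpa using h2
  · exact .list_ofFn_zpow (fun j => top_gen_mem_naturalGens _ j) _

theorem palindromicWidth_le {d n : ℕ} (hn : 1 ≤ n) {G : Type*} [Group G]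
    {x : Fin d → G} (hx : Subgroup.closure (Set.range x) = ⊤) {m : ℕ}
    (hm : d + 4 * n + 6 ≤ m) :
    palindromicWidth (naturalGens (Set.range x) (standardGens n)) ≤ (m : ℕ∞) :=
  iInf₂_le m fun w =>
    (isProdOfPalindromes_of_closure_eq_top ⟨0, hn⟩ hx w).mono (by lia)

end RestrictedWreath

theorem mainTheorem1 (d n : ℕ) (hn : 1 ≤ n) :
    -- the free group of rank `d` with its free generators
    ((Even n →
        palindromicWidth (RestrictedWreath.naturalGens
          (Set.range (FreeGroup.of : Fin d → FreeGroup (Fin d))) (FreeAb.standardGens n))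
          ≤ ((5 * d + 9 * n : ℕ) : ℕ∞)) ∧
      (Odd n →
        palindromicWidth (RestrictedWreath.naturalGens
          (Set.range (FreeGroup.of : Fin d → FreeGroup (Fin d))) (FreeAb.standardGens n))
          ≤ ((5 * d + 9 * n + 2 : ℕ) : ℕ∞))) ∧
    -- an arbitrary group generated by `d` elements
    ∀ (G : Type*) [Group G] (x : Fin d → G), Subgroup.closure (Set.range x) = ⊤ →
      (Even n →
        palindromicWidth (RestrictedWreath.naturalGens (Set.range x) (FreeAb.standardGens n))
          ≤ ((5 * d + 9 * n : ℕ) : ℕ∞)) ∧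
      (Odd n →
        palindromicWidth (RestrictedWreath.naturalGens (Set.range x) (FreeAb.standardGens n))
          ≤ ((5 * d + 9 * n + 2 : ℕ) : ℕ∞)) := by
  refine ⟨⟨fun h => ?_, fun _ => ?_⟩, fun G _ x hx => ⟨fun h => ?_, fun _ => ?_⟩⟩
  -- Evenness forces `n ≥ 2`, so `5 * n ≥ 6`; at `n = 1` the extra 2 of the odd case is needed when
  -- `d = 0`.
  · obtain ⟨m, rfl⟩ := h
    exact RestrictedWreath.palindromicWidth_le hn (FreeGroup.closure_range_of _) (by lia)
  · exact RestrictedWreath.palindromicWidth_le hn (FreeGroup.closure_range_of _) (by lia)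
  · obtain ⟨m, rfl⟩ := h
    exact RestrictedWreath.palindromicWidth_le hn hx (by lia)
  · exact RestrictedWreath.palindromicWidth_le hn hx (by lia)
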